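/- Let $A,B\subseteq\mathbb{R}$ be two independent homogeneous Poisson processes on the line, of intensities $\alpha>0$ and $\beta>0$ (possibly different), defined on a common probability space and regarded as random metric spaces with the metric inherited from $\mathbb{R}$, and let $M,D,R\ge 0$ be fixed constants. Two metric spaces $X$ and $Y$ are called rough isometric with constants $(M,D,R)$ if there is a mapping $T\colon X\to Y$ such that (i) for all $x_1,x_2\in X$, $$\frac1M\,d_X(x_1,x_2)-D\;\le\; d_Y(T(x_1),T(x_2))\;\le\; M\,d_X(x_1,x_2)+D,$$ and (ii) for every $y\in Y$ there is some $x\in X$ with $d_Y(y,T(x))\le R$ (when $M=0$, read $\frac1M$ as $0$). Then the set of outcomes for which $A$ and $B$ are rough isometric with constants $(M,D,R)$ is an event (measurable with respect to the completed probability measure), and its probability is $0$ or $1$. -/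

import Mathlib

open MeasureTheory ProbabilityTheory Set
open scoped NNReal ENNReal

/-- `X` and `Y` are rough isometric with constants `(M, D, R)`: there is a map `T : X → Y` that
distorts distances at most by the factor `M` and the additive constant `D`, and whose image comes
within distance `R` of every point of `Y`. -/
def RoughIsometricWith (M D R : ℝ) (X Y : Type*) [MetricSpace X] [MetricSpace Y] : Prop :=
  ∃ T : X → Y,
    (∀ x₁ x₂ : X, 1 / M * dist x₁ x₂ - D ≤ dist (T x₁) (T x₂) ∧
      dist (T x₁) (T x₂) ≤ M * dist x₁ x₂ + D) ∧
    ∀ y : Y, ∃ x : X, dist y (T x) ≤ R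

/-- The usual σ-algebra on configurations of points of the line: the smallest one for which the
number of points in each Borel set is measurable. -/
noncomputable abbrev configSigma : MeasurableSpace (Set ℝ) :=
  ⨆ s : {s : Set ℝ // MeasurableSet s},
    MeasurableSpace.comap (fun X : Set ℝ => (X ∩ s.1).encard) inferInstance

/-- The random subset `A` of the line is a (homogeneous) Poisson process with intensity `r` under
the probability measure `μ`: the number of points in a Borel set of finite Lebesgue measure `ℓ` is
Poisson distributed with mean `r * ℓ` (so `A` is almost surely locally finite), and the numbers of
points in finitely many pairwise disjoint Borel sets are independent. -/
structure IsPoissonProcess {Ω : Type*} [MeasurableSpace Ω] (μ : Measure Ω) (r : ℝ≥0)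
    (A : Ω → Set ℝ) : Prop where
  measurable_count : ∀ s : Set ℝ, MeasurableSet s → Measurable fun ω => (A ω ∩ s).encard
  law_count : ∀ s : Set ℝ, MeasurableSet s → volume s ≠ ∞ →
    μ.map (fun ω => (A ω ∩ s).encard) =
      (poissonMeasure (r * (volume s).toNNReal)).map (fun n : ℕ => (n : ℕ∞))
  indep_count : ∀ (n : ℕ) (s : Fin n → Set ℝ), (∀ i, MeasurableSet (s i)) →
    Pairwise (fun i j => Disjoint (s i) (s j)) →
    iIndepFun (fun i ω => (A ω ∩ s i).encard) μ

/-- The random subsets `A` and `B` of the line are independent, that is, the σ-algebras that they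
generate are independent. -/
def IndepConfig {Ω : Type*} [MeasurableSpace Ω] (μ : Measure Ω) (A B : Ω → Set ℝ) : Prop :=
  Indep (configSigma.comap A) (configSigma.comap B) μ

/-! Rough isometry depends on each configuration only up to isometry, so the event is invariant
under integer translations of `A` and of `B` separately. Translation-invariant events of one Poisson
process are trivial (`Config.measure_eq_zero_or_one_of_shift_invariant`): approximate `E` by an
event `C` that depends on a bounded window. By stationarity a far translate of `C` approximates `E`
equally well, and it is independent of `C`, so `P E = P E * P E`. Applied to the sections of the
event, and then by Fubini to the set of first configurations whose section has probability one, this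
settles the pair (`prod_eq_zero_or_one_of_shift_invariant`).

Measurability is delicate because the map `T` ranges over an uncountable set. Almost surely both
configurations are locally finite and unbounded above, so their points have a measurable enumeration
`nextPoint`. A compactness argument (`HasFiniteApproximations.roughIsometricWith`) then replaces `T`
by finite partial maps, which leaves only countable quantifiers. Compactness needs `0 < M`; for `M =
0` the target would be bounded, so no proper pair qualifies. -/

/-- Isometric spaces are interchangeable in the definition of rough isometry. -/
theorem RoughIsometricWith.congr {M D R : ℝ} {X X' Y Y' : Type*} [MetricSpace X] [MetricSpace X']
    [MetricSpace Y] [MetricSpace Y'] (e : X ≃ᵢ X') (f : Y ≃ᵢ Y')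
    (h : RoughIsometricWith M D R X Y) : RoughIsometricWith M D R X' Y' := by
  obtain ⟨T, hT, hR⟩ := h
  refine ⟨fun x => f (T (e.symm x)), fun x₁ x₂ => ?_, fun y => ?_⟩
  · simpa only [f.dist_eq, e.symm.dist_eq] using hT (e.symm x₁) (e.symm x₂)
  · obtain ⟨x, hx⟩ := hR (f.symm y)
    refine ⟨e x, ?_⟩
    rw [← f.dist_eq] at hx
    simpa using hx

/-- If `M = 0`, a rough isometry has bounded image, so its target is bounded. -/
theorem not_roughIsometricWith_zero {D R : ℝ} {X Y : Set ℝ} (hY : ¬ BddAbove Y) :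
    ¬ RoughIsometricWith 0 D R X Y := by
  rintro ⟨T, hT, hR⟩
  obtain ⟨y₀, hy₀, -⟩ := not_bddAbove_iff.1 hY 0
  obtain ⟨x₀, -⟩ := hR ⟨y₀, hy₀⟩
  refine hY ⟨T x₀ + D + R, fun y hy => ?_⟩
  obtain ⟨x, hx⟩ := hR ⟨y, hy⟩
  have h := (hT x x₀).2
  rw [zero_mul, zero_add, Subtype.dist_eq, Real.dist_eq] at h
  rw [Subtype.dist_eq, Real.dist_eq] at hx
  linarith [le_abs_self (y - T x), le_abs_self ((T x : ℝ) - T x₀)]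

/-! ### Compactness: rough isometries from finite approximations -/

/-- The finite relation `W` on the index set is, for the points `p i` and `q j`, (part of) a map
that satisfies the distortion bounds of a rough isometry. -/
def IsRoughRelation {ι : Type*} (M D : ℝ) (p q : ι → ℝ) (W : Finset (ι × ι)) : Prop :=
  ∀ w ∈ W, ∀ w' ∈ W, (p w.1 = p w'.1 → q w.2 = q w'.2) ∧
    1 / M * |p w.1 - p w'.1| - D ≤ |q w.2 - q w'.2| ∧
    |q w.2 - q w'.2| ≤ M * |p w.1 - p w'.1| + D

/-- There are finite partial rough isometries, defined on any given finite set of points and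
almost reaching any given finite set of points, that agree at one point. -/
def HasFiniteApproximations {ι : Type*} (M D R : ℝ) (p q : ι → ℝ) : Prop :=
  ∃ i₀ j₀, ∀ F G : Finset ι, ∃ W : Finset (ι × ι), (i₀, j₀) ∈ W ∧ (∀ i ∈ F, ∃ j, (i, j) ∈ W) ∧
    IsRoughRelation M D p q W ∧ ∀ j ∈ G, ∃ w ∈ W, |q j - q w.2| ≤ R

theorem RoughIsometricWith.hasFiniteApproximations {ι : Type*} [Nonempty ι] {M D R : ℝ}
    {p q : ι → ℝ} (h : RoughIsometricWith M D R (range p) (range q)) :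
    HasFiniteApproximations M D R p q := by
  classical
  obtain ⟨T, hT, hR⟩ := h
  choose τ hτ using fun i => (T ⟨p i, mem_range_self i⟩).2
  have hσ : ∀ j, ∃ i, |q j - q (τ i)| ≤ R := fun j => by
    obtain ⟨⟨_, i, rfl⟩, hx⟩ := hR ⟨q j, mem_range_self j⟩
    exact ⟨i, by rwa [hτ]⟩
  choose σ hσ using hσ
  obtain ⟨i₀⟩ := ‹Nonempty ι›
  refine ⟨i₀, τ i₀, fun F G => ⟨(insert i₀ (F ∪ G.image σ)).image fun i => (i, τ i), ?_, ?_, ?_, ?_⟩⟩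
  · exact Finset.mem_image_of_mem (fun i => (i, τ i)) (Finset.mem_insert_self _ _)
  · exact fun i hi => ⟨τ i, Finset.mem_image_of_mem (fun i => (i, τ i))
      (Finset.mem_insert_of_mem (Finset.mem_union_left _ hi))⟩
  · intro w hw w' hw'
    obtain ⟨i, -, rfl⟩ := Finset.mem_image.1 hw
    obtain ⟨i', -, rfl⟩ := Finset.mem_image.1 hw'
    have := hT ⟨p i, mem_range_self i⟩ ⟨p i', mem_range_self i'⟩
    rw [Subtype.dist_eq, Subtype.dist_eq, Real.dist_eq, Real.dist_eq, ← hτ, ← hτ] at this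
    refine ⟨fun hp => ?_, this⟩
    simp only at hp ⊢
    rw [hτ, hτ]
    simp only [hp]
  · exact fun j hj => ⟨(σ j, τ (σ j)), Finset.mem_image_of_mem (fun i => (i, τ i))
      (Finset.mem_insert_of_mem (Finset.mem_union_right _ (Finset.mem_image_of_mem _ hj))), hσ j⟩

/-- All approximations share the pair `(i₀, j₀)`, so the upper bound confines the image of `p i` to
a bounded interval, which holds finitely many points of `range q`. An ultrafilter on the pairs `(F,
G)` selects one of them, and the selected values satisfy the bounds because any two occur together
in some approximation. The lower bound likewise leaves finitely many candidates for a point sent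
near `q j`. -/
theorem HasFiniteApproximations.roughIsometricWith {ι : Type*} {M D R : ℝ} (hM : 0 < M)
    {p q : ι → ℝ} (hp : ∀ a b, (range p ∩ Icc a b).Finite) (hq : ∀ a b, (range q ∩ Icc a b).Finite)
    (h : HasFiniteApproximations M D R p q) :
    RoughIsometricWith M D R (range p) (range q) := by
  classical
  obtain ⟨i₀, j₀, h⟩ := h
  choose W hbase hdom hrel hsurj using fun a : Finset ι × Finset ι => h a.1 a.2
  let 𝒰 : Ultrafilter (Finset ι × Finset ι) := Ultrafilter.of Filter.atTop
  have h𝒰 {P : Finset ι × Finset ι → Prop} (a₀) (hP : ∀ a, a₀ ≤ a → P a) : ∀ᶠ a in 𝒰, P a :=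
    Ultrafilter.of_le Filter.atTop ((Filter.eventually_ge_atTop a₀).mono hP)
  have key : ∀ i, ∃ y ∈ range q ∩ Icc (q j₀ - (M * |p i - p i₀| + D)) (q j₀ + (M * |p i - p i₀| + D)),
      ∀ᶠ a in 𝒰, ∃ j, (i, j) ∈ W a ∧ q j = y := by
    intro i
    refine (Ultrafilter.eventually_exists_mem_iff (hq _ _)).1 (h𝒰 ({i}, ∅) fun a ha => ?_)
    obtain ⟨j, hj⟩ := hdom a i (ha.1 (Finset.mem_singleton_self i))
    have := abs_le.1 (hrel a _ hj _ (hbase a)).2.2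
    simp only at this
    exact ⟨q j, ⟨mem_range_self j, by linarith, by linarith⟩, j, hj, rfl⟩
  choose t ht hW using key
  have hconst : ∀ i, ∀ᶠ a in 𝒰, ∀ w ∈ W a, p w.1 = p i → q w.2 = t i := by
    intro i
    filter_upwards [hW i] with a ha w hw hwi
    obtain ⟨j, hj, hjt⟩ := ha
    exact ((hrel a w hw _ hj).1 hwi).trans hjt
  -- Several indices may name one point; by `hconst` the choice among them does not affect `t`.
  let idx : range p → ι := fun x => x.2.choose
  have hidx : ∀ x : range p, p (idx x) = x := fun x => x.2.choose_spec
  refine ⟨fun x => ⟨t (idx x), (ht _).1⟩, fun x₁ x₂ => ?_, ?_⟩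
  · obtain ⟨a, ⟨j₁, hj₁, e₁⟩, j₂, hj₂, e₂⟩ := ((hW (idx x₁)).and (hW (idx x₂))).exists
    have := (hrel a _ hj₁ _ hj₂).2
    simp only [hidx] at this
    rw [e₁, e₂] at this
    exact this
  · rintro ⟨_, j, rfl⟩
    -- With `d = |p w.1 - p i₀|`, this solves `d / M - D ≤ |q w.2 - q j₀| ≤ |q j - q j₀| + R` for
    -- `d`, using `0 < M`.
    set r := M * (|q j - q j₀| + R + D)
    have hex : ∃ x ∈ range p ∩ Icc (p i₀ - r) (p i₀ + r),
        ∀ᶠ a in 𝒰, ∃ w ∈ W a, p w.1 = x ∧ |q j - q w.2| ≤ R := by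
      refine (Ultrafilter.eventually_exists_mem_iff (hp _ _)).1 (h𝒰 (∅, {j}) fun a ha => ?_)
      obtain ⟨w, hw, hR⟩ := hsurj a j (ha.2 (Finset.mem_singleton_self j))
      have h1 := (hrel a _ hw _ (hbase a)).2.1
      simp only at h1
      have h2 : |q w.2 - q j₀| ≤ |q j - q j₀| + R := by
        have := abs_sub_le (q w.2) (q j) (q j₀)
        rw [abs_sub_comm (q w.2) (q j)] at this
        linarith
      have h3 : |p w.1 - p i₀| ≤ r := by
        rw [one_div, inv_mul_eq_div, sub_le_iff_le_add, div_le_iff₀' hM] at h1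
        exact h1.trans (mul_le_mul_of_nonneg_left (by linarith) hM.le)
      have := abs_le.1 h3
      exact ⟨p w.1, ⟨mem_range_self _, by linarith, by linarith⟩, w, hw, rfl, hR⟩
    obtain ⟨x, ⟨hx, -⟩, hev⟩ := hex
    obtain ⟨a, ⟨w, hw, hwx, hR⟩, ha⟩ := (hev.and (hconst (idx ⟨x, hx⟩))).exists
    refine ⟨⟨x, hx⟩, ?_⟩
    rw [Subtype.dist_eq, Real.dist_eq]
    rwa [ha w hw (by rw [hidx, hwx])] at hR

/-! ### Configurations and their dyadic counts -/

/-- A configuration of points of the line. -/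
structure Config where
  /-- The set of points of the configuration. -/
  points : Set ℝ

namespace Config

/-- The dyadic interval `[k / 2 ^ n, (k + 1) / 2 ^ n)`. -/
def cell (n : ℕ) (k : ℤ) : Set ℝ := Ico (k / 2 ^ n) ((k + 1) / 2 ^ n)

/-- The number of points in a dyadic interval. -/
noncomputable def cellCount (n : ℕ) (k : ℤ) (X : Config) : ℕ∞ := (X.points ∩ cell n k).encard

/-- The σ-algebra generated by the numbers of points in the dyadic intervals. -/
noncomputable instance : MeasurableSpace Config := ⨆ n, ⨆ k, MeasurableSpace.comap (cellCount n k) inferInstance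

theorem measurable_cellCount (n : ℕ) (k : ℤ) : Measurable (cellCount n k) :=
  measurable_iff_comap_le.2 (le_iSup₂_of_le n k le_rfl)

theorem mem_cell {n : ℕ} {k : ℤ} {x : ℝ} : x ∈ cell n k ↔ ⌊x * 2 ^ n⌋ = k := by
  have : (0 : ℝ) < 2 ^ n := by positivity
  rw [cell, mem_Ico, div_le_iff₀ this, lt_div_iff₀ this, Int.floor_eq_iff]

theorem measurableSet_cell (n : ℕ) (k : ℤ) : MeasurableSet (cell n k) := measurableSet_Ico

theorem pairwise_disjoint_cell (n : ℕ) : Pairwise fun k l => Disjoint (cell n k) (cell n l) :=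
  fun _ _ hkl => Set.disjoint_left.2 fun _ hk hl => hkl ((mem_cell.1 hk).symm.trans (mem_cell.1 hl))

theorem cellCount_eq_zero {n : ℕ} {k : ℤ} {X : Config} :
    cellCount n k X = 0 ↔ X.points ∩ cell n k = ∅ := encard_eq_zero

theorem cell_eq_union (n : ℕ) (k : ℤ) :
    cell n k = cell (n + 1) (2 * k) ∪ cell (n + 1) (2 * k + 1) := by
  ext x
  have h : ⌊x * 2 ^ n⌋ = ⌊x * 2 ^ (n + 1)⌋ / 2 := by
    have := Int.floor_div_natCast (x * 2 ^ (n + 1)) 2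
    push_cast at this
    rw [← this]
    congr 1
    ring
  rw [mem_union, mem_cell, mem_cell, mem_cell, h]
  omega

theorem cellCount_eq_add (n : ℕ) (k : ℤ) (X : Config) :
    cellCount n k X = cellCount (n + 1) (2 * k) X + cellCount (n + 1) (2 * k + 1) X := by
  rw [cellCount, cell_eq_union, inter_union_distrib_left, encard_union_eq]
  · rfl
  · exact (pairwise_disjoint_cell (n + 1) (by omega)).mono inter_subset_right inter_subset_right

/-- The configuration seen from the point `t`. -/
def shift (t : ℤ) (X : Config) : Config := ⟨(fun x : ℝ => x + t) ⁻¹' X.points⟩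

theorem cellCount_shift (n : ℕ) (k t : ℤ) (X : Config) :
    cellCount n k (shift t X) = cellCount n (k + t * 2 ^ n) X := by
  have : (shift t X).points ∩ cell n k =
      (fun x : ℝ => x + t) ⁻¹' (X.points ∩ cell n (k + t * 2 ^ n)) := by
    ext x
    have h : ⌊(x + t) * 2 ^ n⌋ = ⌊x * 2 ^ n⌋ + t * 2 ^ n := by
      rw [← Int.floor_add_intCast]
      push_cast
      ring_nf
    simp only [shift, mem_inter_iff, mem_preimage, mem_cell, h, add_left_inj]
  rw [cellCount, this, encard_preimage_of_bijective (AddGroup.addRight_bijective (t : ℝ))]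
  rfl

theorem measurable_iff_cellCount {β : Type*} [MeasurableSpace β] {f : β → Config} :
    Measurable f ↔ ∀ n k, Measurable fun b => cellCount n k (f b) := by
  refine ⟨fun hf n k => (measurable_cellCount n k).comp hf, fun h => ?_⟩
  rw [measurable_iff_comap_le]
  simp only [instMeasurableSpace, MeasurableSpace.comap_iSup, MeasurableSpace.comap_comp, iSup_le_iff]
  exact fun n k => measurable_iff_comap_le.1 (h n k)

theorem measurable_shift (t : ℤ) : Measurable (shift t) := by
  rw [measurable_iff_cellCount]
  intro n k
  simp only [cellCount_shift]
  exact measurable_cellCount _ _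

/-- Locally finite configurations that are unbounded above. -/
def IsProper (X : Config) : Prop :=
  (∀ a b, (X.points ∩ Icc a b).Finite) ∧ ¬ BddAbove X.points

theorem isProper_iff {X : Config} : X.IsProper ↔
    (∀ k, cellCount 0 k X ≠ ⊤) ∧ ∀ m : ℕ, ∃ k : ℤ, m ≤ k ∧ cellCount 0 k X ≠ 0 := by
  refine and_congr ⟨fun h k => ?_, fun h a b => ?_⟩ ⟨fun h m => ?_, fun h => ?_⟩
  · exact (encard_lt_top_iff.2 ((h _ _).subset
      (inter_subset_inter_right _ Ico_subset_Icc_self))).ne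
  · refine ((Set.finite_Icc ⌊a⌋ ⌊b⌋).biUnion fun k _ =>
      encard_lt_top_iff.1 (lt_top_iff_ne_top.2 (h k))).subset fun x hx => ?_
    exact mem_biUnion (x := ⌊x⌋) ⟨Int.floor_mono hx.2.1, Int.floor_mono hx.2.2⟩
      ⟨hx.1, mem_cell.2 (by simp)⟩
  · obtain ⟨x, hx, hmx⟩ := not_bddAbove_iff.1 h m
    refine ⟨⌊x⌋, Int.le_floor.2 (by exact_mod_cast hmx.le), fun h0 => ?_⟩
    exact notMem_empty x (cellCount_eq_zero.1 h0 ▸ ⟨hx, mem_cell.2 (by simp)⟩)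
  · refine not_bddAbove_iff.2 fun a => ?_
    obtain ⟨m, hm⟩ := exists_nat_gt a
    obtain ⟨k, hk, h0⟩ := h m
    obtain ⟨x, hx, hxk⟩ := nonempty_iff_ne_empty.2 (mt cellCount_eq_zero.2 h0)
    refine ⟨x, hx, hm.trans_le ?_⟩
    rw [mem_cell, pow_zero, mul_one] at hxk
    exact_mod_cast Int.le_floor.1 (hxk ▸ hk)

theorem measurableSet_isProper : MeasurableSet {X : Config | X.IsProper} := by
  have hk (k : ℤ) (c : ℕ∞) : MeasurableSet {X | cellCount 0 k X ≠ c} :=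
    measurable_cellCount 0 k (measurableSet_singleton c).compl
  simp only [isProper_iff, ofPred_and, ofPred_forall, ofPred_exists]
  refine (MeasurableSet.iInter fun k => hk k _).inter
    (MeasurableSet.iInter fun m => MeasurableSet.iUnion fun k => ?_)
  exact (MeasurableSet.const _).inter (hk k _)

theorem isProper_shift {t : ℤ} {X : Config} : (shift t X).IsProper ↔ X.IsProper := by
  refine and_congr ⟨fun h a b => ?_, fun h a b => ?_⟩ (not_congr ⟨?_, ?_⟩)
  · refine ((h (a - t) (b - t)).image (· + (t : ℝ))).subset fun x hx => ⟨x - t, ⟨?_, ?_⟩, by simp⟩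
    · simpa [shift] using hx.1
    · exact ⟨sub_le_sub_right hx.2.1 _, sub_le_sub_right hx.2.2 _⟩
  · refine Finite.of_finite_image ((h (a + t) (b + t)).subset ?_)
      (add_left_injective (t : ℝ)).injOn
    rintro _ ⟨x, hx, rfl⟩
    exact ⟨hx.1, by simpa using hx.2⟩
  · rintro ⟨c, hc⟩
    refine ⟨c + t, fun x hx => ?_⟩
    have := @hc (x - t) (by simpa [shift] using hx)
    linarith
  · rintro ⟨c, hc⟩
    refine ⟨c - t, fun x hx => ?_⟩
    have := hc hx
    simp only at this
    linarith

/-! ### Measurable enumeration of the points -/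

/-- The first point of the configuration to the right of the dyadic number `k / 2 ^ n`. -/
noncomputable def nextPoint (i : ℕ × ℤ) (X : Config) : ℝ :=
  sInf (X.points ∩ Ici (i.2 / 2 ^ i.1))

theorem IsProper.isLeast_nextPoint {X : Config} (hX : X.IsProper) (i : ℕ × ℤ) :
    IsLeast (X.points ∩ Ici (i.2 / 2 ^ i.1)) (nextPoint i X) := by
  obtain ⟨b, hb, hib⟩ := not_bddAbove_iff.1 hX.2 (i.2 / 2 ^ i.1)
  obtain ⟨x, ⟨hx, hxi⟩, hmin⟩ := (X.points ∩ Icc (i.2 / 2 ^ i.1 : ℝ) b).exists_min_image id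
    (hX.1 _ _) ⟨b, hb, hib.le, le_rfl⟩
  have h : IsLeast (X.points ∩ Ici (i.2 / 2 ^ i.1)) x := by
    refine ⟨⟨hx, hxi.1⟩, fun y hy => ?_⟩
    rcases le_total y b with hyb | hyb
    · exact hmin y ⟨hy.1, hy.2, hyb⟩
    · exact hxi.2.trans hyb
  rwa [nextPoint, h.csInf_eq]

theorem exists_dyadic_between {c x : ℝ} (h : c < x) : ∃ n : ℕ, c < (⌊x * 2 ^ n⌋ : ℝ) / 2 ^ n := by
  obtain ⟨n, hn⟩ := exists_pow_lt_of_lt_one (sub_pos.2 h) (by norm_num : (1 / 2 : ℝ) < 1)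
  have h2 : (0 : ℝ) < 2 ^ n := by positivity
  refine ⟨n, ?_⟩
  rw [lt_div_iff₀ h2]
  rw [one_div_pow, div_lt_iff₀ h2] at hn
  linarith [Int.lt_floor_add_one (x * 2 ^ n)]

/-- Local finiteness isolates `x` from the other points of `[x - 1, x]`, so `x` is the next point
after any dyadic number close enough below it. -/
theorem IsProper.range_nextPoint {X : Config} (hX : X.IsProper) :
    (range fun i => nextPoint i X) = X.points := by
  refine Subset.antisymm (range_subset_iff.2 fun i => (hX.isLeast_nextPoint i).1.1) fun x hx => ?_
  have hcl : IsClosed ((X.points ∩ Icc (x - 1) x) \ {x}) := ((hX.1 _ _).subset sdiff_subset).isClosed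
  obtain ⟨ε, hε, hball⟩ := Metric.isOpen_iff.1 hcl.isOpen_compl x fun h => h.2 rfl
  obtain ⟨n, hn⟩ := exists_dyadic_between (c := max (x - 1) (x - ε)) (x := x)
    (max_lt (by linarith) (by linarith))
  have hle : (⌊x * 2 ^ n⌋ : ℝ) / 2 ^ n ≤ x :=
    (div_le_iff₀ (by positivity)).2 (Int.floor_le _)
  obtain ⟨⟨hy, hyn⟩, hmin⟩ := hX.isLeast_nextPoint (n, ⌊x * 2 ^ n⌋)
  refine ⟨(n, ⌊x * 2 ^ n⌋), ?_⟩
  by_contra hne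
  have hyx := hmin ⟨hx, hle⟩
  have hyn' := hn.trans_le hyn
  rw [max_lt_iff] at hyn'
  refine hball (a := nextPoint (n, ⌊x * 2 ^ n⌋) X) ?_ ⟨⟨hy, hyn'.1.le, hyx⟩, hne⟩
  rw [Metric.mem_ball, Real.dist_eq, abs_lt]
  constructor <;> linarith [hyn'.2]

theorem IsProper.nextPoint_lt_iff {X : Config} (hX : X.IsProper) {i : ℕ × ℤ} {c : ℝ} :
    nextPoint i X < c ↔ ∃ (m : ℕ) (k : ℤ), (i.2 : ℝ) / 2 ^ i.1 ≤ k / 2 ^ m ∧ ((k : ℝ) + 1) / 2 ^ m ≤ c ∧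
      cellCount m k X ≠ 0 := by
  constructor
  · intro h
    obtain ⟨⟨hy, hyi⟩, -⟩ := hX.isLeast_nextPoint i
    set y := nextPoint i X
    obtain ⟨m, hm⟩ := exists_pow_lt_of_lt_one (sub_pos.2 h) (by norm_num : (1 / 2 : ℝ) < 1)
    -- A level of at least `i.1` makes `i.2 / 2 ^ i.1` a grid point, so the cell of `y` does not
    -- begin to its left.
    have h1 : (1 / 2 : ℝ) ^ (max i.1 m) < c - y :=
      (pow_le_pow_of_le_one (by norm_num) (by norm_num) (le_max_right _ _)).trans_lt hm
    obtain ⟨d, hd⟩ := Nat.exists_eq_add_of_le (le_max_left i.1 m)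
    generalize max i.1 m = n at *
    have h2 : (0 : ℝ) < 2 ^ n := by positivity
    refine ⟨n, ⌊y * 2 ^ n⌋, ?_, ?_, fun h0 => ?_⟩
    · have : ((i.2 * 2 ^ d : ℤ) : ℝ) ≤ ⌊y * 2 ^ n⌋ := by
        refine Int.cast_le.2 (Int.le_floor.2 ?_)
        rw [mem_Ici, div_le_iff₀ (by positivity)] at hyi
        push_cast
        rw [hd, pow_add, ← mul_assoc]
        exact mul_le_mul_of_nonneg_right hyi (by positivity)
      rw [div_le_div_iff₀ (by positivity) h2]
      push_cast at this
      subst hd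
      rw [pow_add] at this ⊢
      calc (i.2 : ℝ) * (2 ^ i.1 * 2 ^ d) = i.2 * 2 ^ d * 2 ^ i.1 := by ring
        _ ≤ _ := mul_le_mul_of_nonneg_right this (by positivity)
    · rw [div_le_iff₀ h2]
      rw [one_div_pow, div_lt_iff₀ h2] at h1
      linarith [Int.floor_le (y * 2 ^ n)]
    · exact notMem_empty y (cellCount_eq_zero.1 h0 ▸ ⟨hy, mem_cell.2 rfl⟩)
  · rintro ⟨m, k, hik, hkc, h0⟩
    obtain ⟨x, hx, hxk⟩ := nonempty_iff_ne_empty.2 (mt cellCount_eq_zero.2 h0)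
    exact ((hX.isLeast_nextPoint i).2 ⟨hx, hik.trans hxk.1⟩).trans_lt (hxk.2.trans_le hkc)

open Classical in
theorem measurable_nextPoint (i : ℕ × ℤ) :
    Measurable fun X : Config => if X.IsProper then nextPoint i X else 0 := by
  refine measurable_of_Iio fun c => ?_
  -- The last piece accounts for the default value `0` on improper configurations.
  have : (fun X : Config => if X.IsProper then nextPoint i X else 0) ⁻¹' Iio c =
      ({X | X.IsProper} ∩ ⋃ (m : ℕ) (k : ℤ) (_ : (i.2 : ℝ) / 2 ^ i.1 ≤ k / 2 ^ m)
        (_ : ((k : ℝ) + 1) / 2 ^ m ≤ c), {X | cellCount m k X ≠ 0}) ∪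
      ({X | X.IsProper}ᶜ ∩ {_X | 0 < c}) := by
    ext X
    by_cases hX : X.IsProper
    · simp [hX, hX.nextPoint_lt_iff, and_left_comm]
    · simp [hX]
  rw [this]
  refine (measurableSet_isProper.inter ?_).union
    (measurableSet_isProper.compl.inter (MeasurableSet.const _))
  exact MeasurableSet.iUnion fun m => MeasurableSet.iUnion fun k => MeasurableSet.iUnion fun _ =>
    MeasurableSet.iUnion fun _ => measurable_cellCount m k (measurableSet_singleton 0).compl

/-! ### The rough isometry event: measurability and invariance -/

/-- The pairs of proper configurations that are rough isometric. -/
def roughPairs (M D R : ℝ) : Set (Config × Config) :=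
  {z | z.1.IsProper ∧ z.2.IsProper ∧ RoughIsometricWith M D R z.1.points z.2.points}

theorem roughPairs_zero (D R : ℝ) : roughPairs 0 D R = ∅ :=
  eq_empty_of_forall_notMem fun _ hz => not_roughIsometricWith_zero hz.2.1.2 hz.2.2

theorem IsProper.roughIsometricWith_iff {M D R : ℝ} (hM : 0 < M) {X Y : Config} (hX : X.IsProper)
    (hY : Y.IsProper) : RoughIsometricWith M D R X.points Y.points ↔
      HasFiniteApproximations M D R (fun i => nextPoint i X) fun i => nextPoint i Y := by
  have h : RoughIsometricWith M D R (range fun i => nextPoint i X) (range fun i => nextPoint i Y) ↔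
      HasFiniteApproximations M D R (fun i => nextPoint i X) fun i => nextPoint i Y := by
    refine ⟨fun h => h.hasFiniteApproximations, fun h => h.roughIsometricWith hM ?_ ?_⟩
    · rw [hX.range_nextPoint]; exact hX.1
    · rw [hY.range_nextPoint]; exact hY.1
  rwa [hX.range_nextPoint, hY.range_nextPoint] at h

/-- Indices, finite sets of indices and finite relations form countable types, so only countable
unions and intersections occur. -/
theorem _root_.measurableSet_hasFiniteApproximations {α ι : Type*} [MeasurableSpace α] [Countable ι]
    (M D R : ℝ) {p q : ι → α → ℝ} (hp : ∀ i, Measurable (p i)) (hq : ∀ i, Measurable (q i)) :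
    MeasurableSet {a | HasFiniteApproximations M D R (fun i => p i a) fun i => q i a} := by
  have hpp (i j) : Measurable fun a => |p i a - p j a| := ((hp i).sub (hp j)).norm
  have hqq (i j) : Measurable fun a => |q i a - q j a| := ((hq i).sub (hq j)).norm
  simp only [HasFiniteApproximations, IsRoughRelation, ofPred_exists, ofPred_forall, ofPred_and]
  refine .iUnion fun i₀ => .iUnion fun j₀ => .iInter fun F => .iInter fun G => .iUnion fun W =>
    (MeasurableSet.const _).inter (.inter ?_ (.inter ?_ ?_))
  · exact .iInter fun i => .iInter fun _ => .iUnion fun j => .const _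
  · refine .iInter fun w => .iInter fun _ => .iInter fun w' => .iInter fun _ =>
      .inter ?_ (.inter ?_ ?_)
    · simp only [imp_iff_not_or]
      exact (measurableSet_eq_fun (hp _) (hp _)).compl.union (measurableSet_eq_fun (hq _) (hq _))
    · exact measurableSet_le (((hpp _ _).const_mul _).sub_const _) (hqq _ _)
    · exact measurableSet_le (hqq _ _) (((hpp _ _).const_mul _).add_const _)
  · exact .iInter fun j => .iInter fun _ => .iUnion fun w =>
      (MeasurableSet.const _).inter (measurableSet_le (hqq _ _) measurable_const)

theorem measurableSet_roughPairs {M : ℝ} (hM : 0 ≤ M) (D R : ℝ) :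
    MeasurableSet (roughPairs M D R) := by
  classical
  rcases hM.eq_or_lt with rfl | hM
  · simp [roughPairs_zero]
  let p (i : ℕ × ℤ) (X : Config) : ℝ := if X.IsProper then nextPoint i X else 0
  have : roughPairs M D R = ({z | z.1.IsProper} ∩ {z | z.2.IsProper}) ∩
      {z | HasFiniteApproximations M D R (fun i => p i z.1) fun i => p i z.2} := by
    ext z
    rw [roughPairs, mem_ofPred_eq, ← and_assoc]
    refine and_congr_right fun hz => ?_
    simp only [p, mem_ofPred_eq, if_pos hz.1, if_pos hz.2, hz.1.roughIsometricWith_iff hM hz.2]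
  rw [this]
  refine ((measurable_fst measurableSet_isProper).inter
    (measurable_snd measurableSet_isProper)).inter ?_
  exact measurableSet_hasFiniteApproximations M D R
    (fun i => (measurable_nextPoint i).comp measurable_fst)
    (fun i => (measurable_nextPoint i).comp measurable_snd)

/-- A configuration is isometric to its translates. -/
def shiftIsometry (t : ℤ) (X : Config) : (shift t X).points ≃ᵢ X.points where
  toFun x := ⟨x + t, x.2⟩
  invFun x := ⟨x - t, by simp [shift]⟩
  left_inv x := by simp
  right_inv x := by simp
  isometry_toFun := Isometry.of_dist_eq fun x y => by simp [Subtype.dist_eq]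

theorem shift_fst_mem_roughPairs {M D R : ℝ} {t : ℤ} {X Y : Config} :
    (shift t X, Y) ∈ roughPairs M D R ↔ (X, Y) ∈ roughPairs M D R := by
  simp only [roughPairs, mem_ofPred_eq, isProper_shift]
  exact and_congr_right fun _ => and_congr_right fun _ =>
    ⟨.congr (shiftIsometry t X) (.refl _), .congr (shiftIsometry t X).symm (.refl _)⟩

theorem shift_snd_mem_roughPairs {M D R : ℝ} {t : ℤ} {X Y : Config} :
    (X, shift t Y) ∈ roughPairs M D R ↔ (X, Y) ∈ roughPairs M D R := by
  simp only [roughPairs, mem_ofPred_eq, isProper_shift]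
  exact and_congr_right fun _ => and_congr_right fun _ =>
    ⟨.congr (.refl _) (shiftIsometry t Y), .congr (.refl _) (shiftIsometry t Y).symm⟩

end Config

/-! ### Zero-one law for shift-invariant events -/

open scoped symmDiff in
/-- If `E` can be approximated by pairs of independent events of equal probability, then `E` is
trivial. -/
theorem measure_eq_zero_or_one_of_approx {α : Type*} [MeasurableSpace α] {P : Measure α}
    [IsProbabilityMeasure P] {E : Set α}
    (h : ∀ ε > 0, ∃ C C', P.real (E ∆ C) ≤ ε ∧ P.real (E ∆ C') ≤ ε ∧
      P.real (C ∩ C') = P.real C * P.real C) : P E = 0 ∨ P E = 1 := by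
  have hle (S T : Set α) : P.real S ≤ P.real T + P.real (S ∆ T) :=
    (measureReal_mono (fun x hx => by by_cases hT : x ∈ T <;> simp [mem_symmDiff, hx, hT])).trans
      (measureReal_union_le _ _)
  have key : ∀ ε > 0, |P.real E - P.real E * P.real E| ≤ ε := by
    intro ε hε
    -- Replacing `E` by `C ∩ C'` costs at most two errors, and replacing `P E * P E` by `P C * P C`
    -- two more.
    obtain ⟨C, C', hC, hC', hCC'⟩ := h (ε / 4) (by positivity)
    have h1 := hle E C
    have h2 := hle C E
    rw [symmDiff_comm] at h2
    have h3 : P.real E ≤ P.real (C ∩ C') + (P.real (E ∆ C) + P.real (E ∆ C')) := by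
      refine (measureReal_mono (fun x hx => ?_)).trans ((measureReal_union_le (C ∩ C')
        (E ∆ C ∪ E ∆ C')).trans (add_le_add_right (measureReal_union_le _ _) _))
      by_cases hxC : x ∈ C <;> by_cases hxC' : x ∈ C' <;> simp [mem_symmDiff, hx, hxC, hxC']
    have h4 : P.real (C ∩ C') ≤ P.real E + P.real (E ∆ C) :=
      (measureReal_mono inter_subset_left).trans (by rw [symmDiff_comm]; exact hle C E)
    have hE0 : 0 ≤ P.real E := measureReal_nonneg
    have hE1 : P.real E ≤ 1 := measureReal_le_one
    have hC0 : 0 ≤ P.real C := measureReal_nonneg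
    have hC1 : P.real C ≤ 1 := measureReal_le_one
    rw [hCC'] at h3 h4
    have h5 : |P.real C * P.real C - P.real E * P.real E| ≤ ε / 4 * 2 := by
      rw [mul_self_sub_mul_self, abs_mul, mul_comm]
      refine mul_le_mul ?_ ?_ (abs_nonneg _) (by positivity) <;> rw [abs_le] <;>
        constructor <;> linarith
    rw [abs_le] at h5 ⊢
    constructor <;> linarith
  have h0 : P.real E - P.real E * P.real E = 0 :=
    abs_eq_zero.1 (le_antisymm (le_of_forall_pos_le_add fun ε hε => by simpa using key ε hε)
      (abs_nonneg _))
  have h1 : P.real E * (1 - P.real E) = 0 := by linarith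
  rcases mul_eq_zero.1 h1 with h | h
  · exact .inl ((measureReal_eq_zero_iff).1 h)
  · right
    rw [← ofReal_measureReal (μ := P) (s := E), ← sub_eq_zero.1 h, ENNReal.ofReal_one]

/-- A generating algebra is dense in measure; this supplies the approximation by window events. -/
theorem isSetAlgebra_iUnion_measurableSet {α : Type*}
    {m : ℕ → MeasurableSpace α} (hm : Monotone m) :
    IsSetAlgebra {s | ∃ n, MeasurableSet[m n] s} where
  empty_mem := ⟨0, @MeasurableSet.empty _ (m 0)⟩
  compl_mem := fun _ ⟨n, hs⟩ => ⟨n, @MeasurableSet.compl _ _ (m n) hs⟩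
  union_mem := fun _ _ ⟨n, hs⟩ ⟨k, ht⟩ =>
    ⟨max n k, @MeasurableSet.union _ (m _) _ _ (hm (le_max_left n k) _ hs)
      (hm (le_max_right n k) _ ht)⟩

namespace Config

/-- The σ-algebra generated by the numbers of points in the dyadic intervals of length `2 ^ (-n)`
with indices in `S`. -/
@[reducible]
noncomputable def cellSigma (n : ℕ) (S : Set ℤ) : MeasurableSpace Config :=
  ⨆ k ∈ S, MeasurableSpace.comap (cellCount n k) inferInstance

/-- The σ-algebra generated by the numbers of points in the dyadic intervals of length `2 ^ (-n)`
that lie in `[-n, n)`. -/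
@[reducible]
noncomputable def windowSigma (n : ℕ) : MeasurableSpace Config :=
  cellSigma n (Ico (-(n * 2 ^ n)) (n * 2 ^ n))

theorem cellSigma_le (n : ℕ) (S : Set ℤ) : cellSigma n S ≤ instMeasurableSpace :=
  iSup₂_le fun k _ => (measurable_cellCount n k).comap_le

theorem measurable_cellCount_cellSigma {n : ℕ} {S : Set ℤ} {k : ℤ} (hk : k ∈ S) :
    Measurable[cellSigma n S] (cellCount n k) :=
  measurable_iff_comap_le.2 (le_iSup₂_of_le k hk le_rfl)

theorem cellSigma_le_succ {n : ℕ} {S T : Set ℤ}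
    (h : ∀ k ∈ S, 2 * k ∈ T ∧ 2 * k + 1 ∈ T) : cellSigma n S ≤ cellSigma (n + 1) T := by
  refine iSup₂_le fun k hk => measurable_iff_comap_le.1 ?_
  rw [funext (cellCount_eq_add n k)]
  exact (measurable_cellCount_cellSigma (h k hk).1).add (measurable_cellCount_cellSigma (h k hk).2)

theorem windowSigma_mono : Monotone windowSigma := by
  refine monotone_nat_of_le_succ fun n => cellSigma_le_succ fun k hk => ?_
  have h : ((n + 1 : ℕ) : ℤ) * 2 ^ (n + 1) = 2 * (n * 2 ^ n) + 2 * 2 ^ n := by push_cast; ring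
  have h2 : (0 : ℤ) < 2 ^ n := by positivity
  simp only [mem_Ico, h] at hk ⊢
  generalize (n : ℤ) * 2 ^ n = a at *
  generalize (2 : ℤ) ^ n = b at *
  omega

theorem comap_cellCount_le_cellSigma (n : ℕ) (k : ℤ) (d : ℕ) :
    MeasurableSpace.comap (cellCount n k) inferInstance ≤
      cellSigma (n + d) (Ico (k * 2 ^ d) ((k + 1) * 2 ^ d)) := by
  induction d with
  | zero => exact measurable_iff_comap_le.1 (measurable_cellCount_cellSigma (by simp))
  | succ d ih =>
    refine ih.trans (cellSigma_le_succ fun j hj => ?_)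
    simp only [mem_Ico, pow_succ, ← mul_assoc] at hj ⊢
    omega

theorem iSup_windowSigma : ⨆ n, windowSigma n = instMeasurableSpace := by
  refine le_antisymm (iSup_le fun n => cellSigma_le _ _) (iSup₂_le fun n k => ?_)
  have hk := comap_cellCount_le_cellSigma n k (k.natAbs + 1)
  -- The cell lies in `[-(|k| + 1), |k| + 1)`, hence in the window of this index, whose grid refines
  -- level `n`.
  refine le_iSup_of_le (n + (k.natAbs + 1)) (hk.trans (biSup_mono fun j hj => ?_))
  have h1 : (1 : ℤ) ≤ 2 ^ n := one_le_pow₀ (by norm_num)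
  have h2 : (0 : ℤ) < 2 ^ (k.natAbs + 1) := by positivity
  have h3 : |k| + 1 ≤ ((n + (k.natAbs + 1) : ℕ) : ℤ) * 2 ^ n := by
    have : |k| + 1 ≤ ((n + (k.natAbs + 1) : ℕ) : ℤ) := by
      rw [Int.abs_eq_natAbs]
      omega
    exact this.trans (le_mul_of_one_le_right (by positivity) h1)
  have h4 := abs_le.1 (le_refl |k|)
  rw [mem_Ico, pow_add, ← mul_assoc, ← neg_mul]
  exact ⟨(mul_le_mul_of_nonneg_right (by linarith) h2.le).trans hj.1,
    hj.2.trans_le (mul_le_mul_of_nonneg_right (by linarith) h2.le)⟩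

theorem instMeasurableSpace_eq_generateFrom : (instMeasurableSpace : MeasurableSpace Config) =
    MeasurableSpace.generateFrom {s | ∃ n, MeasurableSet[windowSigma n] s} := by
  rw [← iSup_windowSigma, MeasurableSpace.measurableSpace_iSup_eq]

theorem measurable_shift_cellSigma {n : ℕ} {t : ℤ} {S T : Set ℤ} (h : ∀ k ∈ S, k + t * 2 ^ n ∈ T) :
    Measurable[cellSigma n T, cellSigma n S] (shift t) := by
  rw [measurable_iff_comap_le, cellSigma]
  simp only [MeasurableSpace.comap_iSup, MeasurableSpace.comap_comp]
  refine iSup₂_le fun k hk => measurable_iff_comap_le.1 ?_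
  have : cellCount n k ∘ shift t = cellCount n (k + t * 2 ^ n) := funext (cellCount_shift n k t)
  rw [this]
  exact measurable_cellCount_cellSigma (h k hk)

open scoped symmDiff in
/-- Zero-one law: if the numbers of points in disjoint dyadic intervals are independent and the law
of the configuration is stationary, then shift-invariant events are trivial. -/
theorem measure_eq_zero_or_one_of_shift_invariant {P : Measure Config} [IsProbabilityMeasure P]
    (hindep : ∀ n, iIndepFun (fun k => cellCount n k) P) (hshift : ∀ t, P.map (shift t) = P)
    {E : Set Config} (hE : MeasurableSet E) (hinv : ∀ t, shift t ⁻¹' E = E) :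
    P E = 0 ∨ P E = 1 := by
  refine measure_eq_zero_or_one_of_approx fun ε hε => ?_
  obtain ⟨C, ⟨n, hC⟩, hEC⟩ := (Measure.MeasureDense.of_generateFrom_isSetAlgebra_finite (μ := P)
    (isSetAlgebra_iUnion_measurableSet windowSigma_mono)
    instMeasurableSpace_eq_generateFrom).approx E hE (measure_ne_top _ _) ε hε
  have hC' : MeasurableSet C := cellSigma_le _ _ _ hC
  have hEC' : P.real (E ∆ C) ≤ ε := ENNReal.toReal_le_of_le_ofReal hε.le hEC.le
  have hreal {S : Set Config} (hS : MeasurableSet S) (t) : P.real (shift t ⁻¹' S) = P.real S := by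
    rw [← map_measureReal_apply (measurable_shift t) hS, hshift]
  -- Translation by `2 * n` carries the window `[-n, n)` to the disjoint `[n, 3n)`.
  refine ⟨C, shift (2 * n) ⁻¹' C, hEC', ?_, ?_⟩
  · rw [← hreal (hE.symmDiff hC') (2 * n), preimage_symmDiff, hinv] at hEC'
    exact hEC'
  · have hdisj : Disjoint (Ico (-(n * 2 ^ n) : ℤ) (n * 2 ^ n)) (Ici (n * 2 ^ n)) :=
      Set.disjoint_left.2 fun k hk hk' => hk.2.not_ge hk'
    have hI := indep_iSup_of_disjoint (fun k => (measurable_cellCount n k).comap_le) (hindep n) hdisj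
    have h := (Indep_iff _ _ _).1 hI C (shift (2 * n) ⁻¹' C) hC
      (measurable_shift_cellSigma (fun k hk => by simp only [mem_Ici, mem_Ico] at hk ⊢; linarith) hC)
    rw [measureReal_def, h, ENNReal.toReal_mul, ← measureReal_def, ← measureReal_def,
      hreal hC']

end Config

/-! ### Poisson processes: independence, stationarity, properness -/

namespace IsPoissonProcess

open Config

variable {Ω : Type*} [MeasurableSpace Ω] {μ : Measure Ω} {r : ℝ≥0} {A : Ω → Set ℝ}

theorem measurable_config (hA : IsPoissonProcess μ r A) : Measurable fun ω => Config.mk (A ω) :=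
  measurable_iff_cellCount.2 fun _ _ => hA.measurable_count _ (measurableSet_cell _ _)

theorem map_cellCount (hA : IsPoissonProcess μ r A) (n : ℕ) (k : ℤ) :
    (μ.map fun ω => Config.mk (A ω)).map (cellCount n k) =
      (poissonMeasure (r * (volume (cell n 0)).toNNReal)).map fun n : ℕ => (n : ℕ∞) := by
  have hvol (l) : volume (cell n l) = ENNReal.ofReal (1 / 2 ^ n) := by
    rw [cell, Real.volume_Ico]
    congr 1
    ring
  rw [Measure.map_map (measurable_cellCount n k) hA.measurable_config, hvol, ← hvol k]
  exact hA.law_count _ (measurableSet_cell n k) (by simp [hvol])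

theorem iIndepFun_cellCount (hA : IsPoissonProcess μ r A) (n : ℕ) :
    iIndepFun (fun k => cellCount n k) (μ.map fun ω => Config.mk (A ω)) := by
  have h : iIndepFun (fun k ω => cellCount n k ⟨A ω⟩) μ := by
    -- Independence is tested on finite subfamilies, numbered by `Fin` to match `indep_count`.
    refine iIndepFun_iff_finset.2 fun s => iIndepFun.of_precomp s.equivFin.symm.surjective ?_
    refine hA.indep_count s.card (fun i => cell n (s.equivFin.symm i))
      (fun _ => measurableSet_cell _ _) fun i j hij => pairwise_disjoint_cell n fun h => hij ?_
    exact s.equivFin.symm.injective (Subtype.ext h)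
  rw [iIndepFun_iff_measure_inter_preimage_eq_mul] at h ⊢
  intro S sets hsets
  have hm (k) (hk : k ∈ S) : MeasurableSet (cellCount n k ⁻¹' sets k) :=
    measurable_cellCount n k (hsets k hk)
  rw [Measure.map_apply hA.measurable_config (S.measurableSet_biInter hm),
    Finset.prod_congr rfl fun k hk => Measure.map_apply hA.measurable_config (hm k hk)]
  rw [preimage_iInter₂]
  exact h S hsets

/-- At each level the cell counts are independent with one common law, so translating the indices
preserves their product law. Window events form a generating π-system and are determined by the
counts at a single level. -/
theorem map_shift [IsProbabilityMeasure μ] (hA : IsPoissonProcess μ r A) (t : ℤ) :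
    (μ.map fun ω => Config.mk (A ω)).map (shift t) = μ.map fun ω => Config.mk (A ω) := by
  set P := μ.map fun ω => Config.mk (A ω) with hP
  have : IsProbabilityMeasure P := Measure.isProbabilityMeasure_map hA.measurable_config.aemeasurable
  have : IsProbabilityMeasure (P.map (shift t)) :=
    Measure.isProbabilityMeasure_map (measurable_shift t).aemeasurable
  have hmono : Monotone fun n => {s | MeasurableSet[windowSigma n] s} :=
    fun m n hmn s hs => windowSigma_mono hmn s hs
  refine ext_of_generate_finite _ instMeasurableSpace_eq_generateFrom ?_ ?_ (by simp)
  · rw [← iUnion_ofPred]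
    exact isPiSystem_iUnion_of_monotone _
      (fun n => @MeasurableSpace.isPiSystem_measurableSet _ (windowSigma n)) hmono
  rintro s ⟨n, hs⟩
  let φ (c : ℤ) (X : Config) (k : ℤ) : ℕ∞ := cellCount n (k + c) X
  have hφ c : Measurable (φ c) := measurable_pi_lambda _ fun k => measurable_cellCount n _
  have hle : windowSigma n ≤ MeasurableSpace.comap (φ 0) inferInstance := by
    refine iSup₂_le fun k _ => ?_
    have : cellCount n k = (fun f : ℤ → ℕ∞ => f k) ∘ φ 0 := by ext X; simp [φ]
    rw [this, ← MeasurableSpace.comap_comp]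
    exact MeasurableSpace.comap_mono (measurable_pi_apply k).comap_le
  obtain ⟨V, hV, rfl⟩ := hle s hs
  have hlaw c : P.map (φ c) = Measure.infinitePi fun _ : ℤ =>
      (poissonMeasure (r * (volume (cell n 0)).toNNReal)).map fun n : ℕ => (n : ℕ∞) := by
    have h := (hA.iIndepFun_cellCount n).precomp (add_left_injective c)
    rw [iIndepFun_iff_map_fun_eq_infinitePi_map fun k => measurable_cellCount n (k + c)] at h
    simp only [hA.map_cellCount] at h
    exact h
  have hcomp : φ 0 ∘ shift t = φ (t * 2 ^ n) := by
    ext X k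
    simp [φ, cellCount_shift]
  rw [Measure.map_apply (measurable_shift t) (hφ 0 hV), ← preimage_comp, hcomp,
    ← Measure.map_apply (hφ _) hV, ← Measure.map_apply (hφ _) hV, hlaw, hlaw]

/-- Poisson counts are finite, and a half-line is empty with probability at most `exp (-r * L)` for
every `L`, which tends to zero as `0 < r`. -/
theorem ae_isProper [IsProbabilityMeasure μ] (hA : IsPoissonProcess μ r A) (hr : 0 < r) :
    ∀ᵐ ω ∂μ, (Config.mk (A ω)).IsProper := by
  have hfin (k : ℤ) : ∀ᵐ ω ∂μ, cellCount 0 k ⟨A ω⟩ ≠ ⊤ := by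
    refine ae_of_ae_map (p := fun c => c ≠ ⊤)
      (hA.measurable_count _ (measurableSet_cell 0 k)).aemeasurable ?_
    rw [hA.law_count _ (measurableSet_cell 0 k) (by simp [cell])]
    exact (ae_map_iff measurable_from_top.aemeasurable (measurableSet_singleton _).compl).2
      (ae_of_all _ fun n => ENat.natCast_ne_top n)
  have hbdd (m : ℕ) : ∀ᵐ ω ∂μ, (A ω ∩ Ici (m : ℝ)).Nonempty := by
    have hle (L : ℕ) : μ {ω | ¬ (A ω ∩ Ici (m : ℝ)).Nonempty} ≤
        ENNReal.ofReal (Real.exp (-r * L)) := by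
      have hs : MeasurableSet (Ico (m : ℝ) (m + L)) := measurableSet_Ico
      have h := congrArg (fun ν => ν {0}) (hA.law_count _ hs (by simp))
      rw [Measure.map_apply (hA.measurable_count _ hs) (measurableSet_singleton 0),
        Measure.map_apply measurable_from_top (measurableSet_singleton 0)] at h
      have h0 : (fun n : ℕ => (n : ℕ∞)) ⁻¹' {0} = {0} := by ext; simp
      rw [h0, poissonMeasure_singleton] at h
      simp only [Real.volume_Ico, add_sub_cancel_left, pow_zero, Nat.factorial_zero, Nat.cast_one,
        mul_one, div_one, ENNReal.ofReal_natCast, ENNReal.toNNReal_natCast, NNReal.coe_mul,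
        NNReal.coe_natCast] at h
      rw [neg_mul, ← h]
      refine measure_mono fun ω hω => encard_eq_zero.2 ?_
      exact subset_eq_empty (inter_subset_inter_right _ Ico_subset_Ici_self)
        (not_nonempty_iff_eq_empty.1 hω)
    have htend : Filter.Tendsto (fun L : ℕ => ENNReal.ofReal (Real.exp (-r * L))) Filter.atTop
        (nhds 0) := by
      rw [← ENNReal.ofReal_zero]
      refine ENNReal.tendsto_ofReal (Real.tendsto_exp_atBot.comp ?_)
      exact tendsto_natCast_atTop_atTop.const_mul_atTop_of_neg (neg_lt_zero.2 hr)
    exact le_antisymm (ge_of_tendsto' htend hle) bot_le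
  filter_upwards [ae_all_iff.2 hfin, ae_all_iff.2 hbdd] with ω h1 h2
  refine isProper_iff.2 ⟨h1, fun m => ?_⟩
  obtain ⟨x, hx, hmx⟩ := h2 m
  refine ⟨⌊x⌋, Int.le_floor.2 (by exact_mod_cast hmx), fun h0 => ?_⟩
  exact notMem_empty x (cellCount_eq_zero.1 h0 ▸ ⟨hx, mem_cell.2 (by simp)⟩)

theorem measure_eq_zero_or_one_of_shift_invariant [IsProbabilityMeasure μ]
    (hA : IsPoissonProcess μ r A) {E : Set Config} (hE : MeasurableSet E)
    (hinv : ∀ t, shift t ⁻¹' E = E) :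
    (μ.map fun ω => Config.mk (A ω)) E = 0 ∨ (μ.map fun ω => Config.mk (A ω)) E = 1 :=
  have := Measure.isProbabilityMeasure_map (μ := μ) hA.measurable_config.aemeasurable
  Config.measure_eq_zero_or_one_of_shift_invariant hA.iIndepFun_cellCount hA.map_shift hE hinv

end IsPoissonProcess

/-! ### Independent pairs and the conclusion -/

/-- A measurable event about a pair of independent configurations is trivial if it is invariant
under separate shifts and shift-invariant events are trivial for both configurations. -/
theorem prod_eq_zero_or_one_of_shift_invariant {P Q : Measure Config} [IsProbabilityMeasure P]
    [IsProbabilityMeasure Q]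
    (hP : ∀ E, MeasurableSet E → (∀ t, Config.shift t ⁻¹' E = E) → P E = 0 ∨ P E = 1)
    (hQ : ∀ E, MeasurableSet E → (∀ t, Config.shift t ⁻¹' E = E) → Q E = 0 ∨ Q E = 1)
    {S : Set (Config × Config)} (hS : MeasurableSet S)
    (h₁ : ∀ t X Y, (Config.shift t X, Y) ∈ S ↔ (X, Y) ∈ S)
    (h₂ : ∀ t X Y, (X, Config.shift t Y) ∈ S ↔ (X, Y) ∈ S) :
    P.prod Q S = 0 ∨ P.prod Q S = 1 := by
  have hsec (X) : Q (Prod.mk X ⁻¹' S) = 0 ∨ Q (Prod.mk X ⁻¹' S) = 1 :=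
    hQ _ (measurable_prodMk_left hS) fun t => by ext Y; exact h₂ t X Y
  have hU : MeasurableSet {X | Q (Prod.mk X ⁻¹' S) = 1} :=
    measurable_measure_prodMk_left hS (measurableSet_singleton 1)
  -- Section probabilities are `0` or `1`, so their integral is the measure of the set where they
  -- equal `1`.
  have hprod : P.prod Q S = P {X | Q (Prod.mk X ⁻¹' S) = 1} := by
    rw [Measure.prod_apply hS, ← lintegral_indicator_one hU]
    refine lintegral_congr fun X => ?_
    rcases hsec X with h | h <;> simp [indicator, h]
  rw [hprod]
  refine hP _ hU fun t => ?_
  ext X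
  have : Prod.mk (Config.shift t X) ⁻¹' S = Prod.mk X ⁻¹' S := by ext Y; exact h₁ t X Y
  simp [this]

/-- Dyadic intervals are Borel, so the dyadic counts generate no more than `configSigma`, and
independence passes to smaller σ-algebras. -/
theorem IndepConfig.indepFun {Ω : Type*} [MeasurableSpace Ω] {μ : Measure Ω} {A B : Ω → Set ℝ}
    (h : IndepConfig μ A B) : IndepFun (fun ω => Config.mk (A ω)) (fun ω => Config.mk (B ω)) μ := by
  have hle (A : Ω → Set ℝ) : MeasurableSpace.comap (fun ω => Config.mk (A ω)) inferInstance ≤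
      configSigma.comap A := by
    have hmk : Measurable[configSigma] Config.mk :=
      (@Config.measurable_iff_cellCount _ configSigma _).2 fun n k => measurable_iff_comap_le.2 (le_iSup_of_le ⟨_, Config.measurableSet_cell n k⟩ le_rfl)
    rw [← Function.comp_def, ← MeasurableSpace.comap_comp]
    exact MeasurableSpace.comap_mono hmk.comap_le
  exact indep_of_indep_of_le_left (indep_of_indep_of_le_right h (hle B)) (hle A)

theorem proposition2p1 {Ω : Type*} [MeasurableSpace Ω] (μ : Measure Ω) [IsProbabilityMeasure μ]
    (α β : ℝ≥0) (hα : 0 < α) (hβ : 0 < β) (A B : Ω → Set ℝ)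
    (hA : IsPoissonProcess μ α A) (hB : IsPoissonProcess μ β B) (hAB : IndepConfig μ A B)
    (M D R : ℝ) (hM : 0 ≤ M) (hD : 0 ≤ D) (hR : 0 ≤ R) :
    NullMeasurableSet {ω | RoughIsometricWith M D R (A ω) (B ω)} μ ∧
      (μ {ω | RoughIsometricWith M D R (A ω) (B ω)} = 0 ∨
        μ {ω | RoughIsometricWith M D R (A ω) (B ω)} = 1) := by
  have hmA := hA.measurable_config
  have hmB := hB.measurable_config
  have hS := Config.measurableSet_roughPairs hM D R
  -- Both configurations are almost surely proper, so the event differs from a measurable one by a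
  -- null set.
  have hae : {ω | RoughIsometricWith M D R (A ω) (B ω)} =ᵐ[μ]
      (fun ω => (Config.mk (A ω), Config.mk (B ω))) ⁻¹' Config.roughPairs M D R := by
    filter_upwards [hA.ae_isProper hα, hB.ae_isProper hβ] with ω h1 h2
    exact propext ⟨fun h => ⟨h1, h2, h⟩, fun h => h.2.2⟩
  refine ⟨(hmA.prodMk hmB hS).nullMeasurableSet.congr hae.symm, ?_⟩
  have := Measure.isProbabilityMeasure_map (μ := μ) hmA.aemeasurable
  have := Measure.isProbabilityMeasure_map (μ := μ) hmB.aemeasurable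
  rw [measure_congr hae, ← Measure.map_apply (hmA.prodMk hmB) hS,
    (indepFun_iff_map_prod_eq_prod_map_map hmA.aemeasurable hmB.aemeasurable).1 hAB.indepFun]
  exact prod_eq_zero_or_one_of_shift_invariant
    (fun _ => hA.measure_eq_zero_or_one_of_shift_invariant)
    (fun _ => hB.measure_eq_zero_or_one_of_shift_invariant) hS
    (fun _ _ _ => Config.shift_fst_mem_roughPairs) (fun _ _ _ => Config.shift_snd_mem_roughPairs)
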